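/- **Theorem (Maxwell's theorem).** Let $(\mathcal A,\varphi)$ be a noncommutative probability space, i.e. a complex unital algebra $\mathcal A$ with a unital linear functional $\varphi:\mathcal A\to\mathbb C$. Let $I$ be an infinite index set and let $(X_i)_{i\in I}\subseteq\mathcal A$ be an interchangeable family, i.e. $$\varphi(X_{\tau(i_1)}X_{\tau(i_2)}\cdots X_{\tau(i_n)})=\varphi(X_{i_1}X_{i_2}\cdots X_{i_n})$$ for every $n$, all $i_1,\dots,i_n\in I$ and every permutation $\tau$ of $I$. Then $(X_i)$ is (centered) Gaussian if and only if it is spherically symmetric. Here, for a set partition $\sigma$ of $\{1,\dots,n\}$, let $\varphi(\sigma)=\varphi(X_{h(1)}X_{h(2)}\cdots X_{h(n)})$, where $h:\{1,\dots,n\}\to I$ is any map whose kernel (the partition into the level sets of $h$) is $\sigma$; by interchangeability this does not depend on $h$. The cumulant corresponding to a partition $\pi$ is $$K_\pi(X,\dots,X)=\sum_{\sigma\le\pi}\varphi(\sigma)\,\mu(\sigma,\pi),$$ where $\le$ is the refinement order and $\mu$ the Möbius function of the lattice of set partitions of $\{1,\dots,n\}$. The family is *(centered) Gaussian* if $K_\pi(X,\dots,X)=0$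 for every $n$ and every partition $\pi$ of $\{1,\dots,n\}$ that is not a pair partition (a partition all of whose blocks have exactly two elements). It is *spherically symmetric* if for every $n\in\mathbb N$, every choice of $n$ distinct members of the family, denoted $X_1,\dots,X_n$, and every real orthogonal matrix $U\in\mathcal O(n)$, the families $Y_i=\sum_{j=1}^n U_{ij}X_j$ and $X_i$ ($1\le i\le n$) have the same joint distribution, i.e. $\varphi(Y_{g(1)}\cdots Y_{g(m)})=\varphi(X_{g(1)}\cdots X_{g(m)})$ for all $m$ and all $g:\{1,\dots,m\}\to\{1,\dots,n\}$. -/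

import Mathlib

/-- The finite set `Π_n` of set partitions of `{1, …, n}`, presented as equivalence relations on
`Fin n`. They are ordered by refinement: `σ ≤ π` means that every block of `σ` is contained in a
block of `π`. -/
abbrev SetPartition (n : ℕ) : Type := Setoid (Fin n)

namespace SetPartition

noncomputable instance instFintype (n : ℕ) : Fintype (SetPartition n) :=
  haveI : Finite (SetPartition n) :=
    Finite.of_injective (fun π : Setoid (Fin n) => fun i j => π i j)
      fun _ _ h => Setoid.ext fun i j => iff_of_eq (congrFun (congrFun h i) j)
  Fintype.ofFinite _

open Classical in
noncomputable instance instLocallyFiniteOrder (n : ℕ) : LocallyFiniteOrder (SetPartition n) :=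
  Fintype.toLocallyFiniteOrder

/-- A pair partition is a partition all of whose blocks have exactly two elements. -/
def IsPair {n : ℕ} (π : SetPartition n) : Prop := ∀ B ∈ π.classes, B.ncard = 2

/-- The Möbius function of the lattice of set partitions. -/
noncomputable def moebius {n : ℕ} (σ π : SetPartition n) : ℂ :=
  letI := Classical.decEq (SetPartition n)
  IncidenceAlgebra.mu ℂ σ π

/-- A multiindex `h : {1, …, n} → I` with kernel `σ`, for an infinite index set `I`. -/
noncomputable def multiindex (ι : Type*) [Infinite ι] {n : ℕ} (σ : SetPartition n) (k : Fin n) :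
    ι :=
  Infinite.natEmbedding ι (Quotient.out (Quotient.mk σ k) : Fin n)

theorem ker_multiindex (ι : Type*) [Infinite ι] {n : ℕ} (σ : SetPartition n) :
    Setoid.ker (multiindex ι σ) = σ := by
  refine Setoid.ext fun i j => ?_
  rw [Setoid.ker_def]
  constructor
  · intro h
    have h1 := Fin.ext ((Infinite.natEmbedding ι).injective h)
    exact Quotient.exact (Quotient.out_injective h1)
  · intro h
    have h1 : Quotient.mk σ i = Quotient.mk σ j := Quotient.sound h
    simp only [multiindex, h1]

end SetPartition

section NoncommutativeProbability

variable {A : Type*} [Ring A] [Algebra ℂ A] {ι κ : Type*}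

/-- The mixed moment `φ(X_{h(1)} X_{h(2)} ⋯ X_{h(n)})`. -/
def mixedMoment (φ : A →ₗ[ℂ] ℂ) (X : ι → A) {n : ℕ} (h : Fin n → ι) : ℂ :=
  φ (List.ofFn fun k => X (h k)).prod

/-- Two families have the same joint distribution if all their mixed moments agree. -/
def SameJointDistribution (φ : A →ₗ[ℂ] ℂ) (X Y : κ → A) : Prop :=
  ∀ (n : ℕ) (h : Fin n → κ), mixedMoment φ X h = mixedMoment φ Y h

/-- A family is interchangeable if its mixed moments are invariant under permutations of the
index set. -/
def Interchangeable (φ : A →ₗ[ℂ] ℂ) (X : ι → A) : Prop :=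
  ∀ τ : Equiv.Perm ι, SameJointDistribution φ (fun i => X (τ i)) X

/-- The partitioned expectation `φ(σ) = φ(X_{h(1)} ⋯ X_{h(n)})`, where `h` is a multiindex with
kernel `σ`; for an interchangeable family the choice of `h` is irrelevant. -/
noncomputable def partitionedMoment [Infinite ι] (φ : A →ₗ[ℂ] ℂ) (X : ι → A) {n : ℕ}
    (σ : SetPartition n) : ℂ :=
  mixedMoment φ X (SetPartition.multiindex ι σ)

theorem mixedMoment_eq_partitionedMoment [Infinite ι] {φ : A →ₗ[ℂ] ℂ} {X : ι → A}
    (hX : Interchangeable φ X) {n : ℕ} (h : Fin n → ι) :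
    mixedMoment φ X h = partitionedMoment φ X (Setoid.ker h) := by
  have hk := SetPartition.ker_multiindex ι (Setoid.ker h)
  have hinj : Function.Injective
      (Quotient.lift (s := Setoid.ker h) (SetPartition.multiindex ι (Setoid.ker h))
        fun i j hij => by
          have h1 : (Setoid.ker h) i j := hij
          rw [← hk] at h1
          exact h1) := by
    rintro ⟨i⟩ ⟨j⟩ hij
    have h1 : Setoid.ker (SetPartition.multiindex ι (Setoid.ker h)) i j := hij
    rw [hk] at h1
    exact Quotient.sound h1
  obtain ⟨τ, hτ⟩ := Equiv.Perm.exists_extending_pair _ _ (Setoid.kerLift_injective h) hinj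
  have h2 : ∀ k, τ (h k) = SetPartition.multiindex ι (Setoid.ker h) k := fun k =>
    hτ (Quotient.mk (Setoid.ker h) k)
  rw [← hX τ n h]
  simp only [partitionedMoment, mixedMoment, h2]

/-- The cumulant `K_π(X, …, X) = ∑_{σ ≤ π} φ(σ) μ(σ, π)` of an interchangeable family. -/
noncomputable def partitionedCumulant [Infinite ι] (φ : A →ₗ[ℂ] ℂ) (X : ι → A) {n : ℕ}
    (π : SetPartition n) : ℂ :=
  ∑ σ ∈ Finset.Icc ⊥ π, partitionedMoment φ X σ * SetPartition.moebius σ π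

/-- An interchangeable family is (centered) Gaussian if all its cumulants which correspond to
non-pair partitions vanish. -/
def IsGaussianFamily [Infinite ι] (φ : A →ₗ[ℂ] ℂ) (X : ι → A) : Prop :=
  ∀ (n : ℕ) (π : SetPartition n), ¬ π.IsPair → partitionedCumulant φ X π = 0

/-- A family is spherically symmetric if for every `n`, every choice of `n` distinct members
`X_1, …, X_n` of it and every real orthogonal `n × n` matrix `U`, the families
`Y_i = ∑_j U_{ij} X_j` and `X_i` (`1 ≤ i ≤ n`) have the same joint distribution. -/
def SphericallySymmetric (φ : A →ₗ[ℂ] ℂ) (X : ι → A) : Prop :=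
  ∀ (n : ℕ) (e : Fin n ↪ ι), ∀ U ∈ Matrix.orthogonalGroup (Fin n) ℝ,
    SameJointDistribution φ (fun i => ∑ j, ((U i j : ℝ) : ℂ) • X (e j)) (fun i => X (e i))

end NoncommutativeProbability

/-!
Write `K π` for the cumulants. Möbius inversion turns their definition into
`φ(X_{h(1)} ⋯ X_{h(n)}) = ∑ K π`, the sum running over the partitions `π` below the kernel of `h`
(`mixedMoment_eq_sum_partitionedCumulant`). Expanding the product of the `Y_i = ∑_j U_{ij} X_j` by
multilinearity and exchanging the two sums gives
`φ(Y_{g(1)} ⋯ Y_{g(n)}) = ∑_π K π · W_π(U, g)` with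
`W_π(U, g) = ∏_{B ∈ π} ∑_i ∏_{k ∈ B} U_{g(k), i}`
(`mixedMoment_linearCombination`), while the moment of the `X_i` has the weight `1` if
`π ≤ ker g` and `0` otherwise.

* If `π` is a pair partition, then every factor of `W_π(U, g)` is an entry of `U Uᵀ = 1`, so that
  both weights agree (`blockWeight_of_isPair`). Hence Gaussian families are spherically symmetric.
* Conversely let `π` have a block `B` with `|B| ≠ 2`, and let `g` have kernel `π`. Rotate the
  variable belonging to `B` by 45 degrees against a fresh variable and leave all others fixed. Then
  the weights of all `σ` that are not below `π` vanish (`blockWeight_rotation_of_not_le`), pair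
  partitions contribute nothing to the difference of the two moments, the `σ < π` contribute
  nothing by induction, and what is left is `0 = K π · (2 · (1 / √2) ^ |B| - 1)`. The last factor
  is nonzero.
-/

open Finset

/-! ### Möbius inversion -/

section MoebiusInversion

variable {A : Type*} [Ring A] [Algebra ℂ A] {ι : Type*} [Infinite ι]

open Classical in
theorem partitionedMoment_eq_sum_partitionedCumulant (φ : A →ₗ[ℂ] ℂ) (X : ι → A) {n : ℕ}
    (π : SetPartition n) :
    partitionedMoment φ X π = ∑ ρ with ρ ≤ π, partitionedCumulant φ X ρ := by
  have hmu (σ : SetPartition n) :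
      ∑ ρ ∈ Icc σ π, SetPartition.moebius σ ρ = if σ = π then 1 else 0 := by
    unfold SetPartition.moebius
    convert IncidenceAlgebra.sum_Icc_mu_right (𝕜 := ℂ) σ π
  symm
  calc ∑ ρ with ρ ≤ π, partitionedCumulant φ X ρ
      = ∑ σ, ∑ ρ ∈ Icc σ π, partitionedMoment φ X σ * SetPartition.moebius σ ρ := by
        unfold partitionedCumulant
        refine Finset.sum_comm' fun ρ σ => ?_
        simp only [mem_filter, mem_univ, true_and, mem_Icc, bot_le]
        tauto
    _ = ∑ σ, partitionedMoment φ X σ * if σ = π then 1 else 0 := by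
        simp_rw [← Finset.mul_sum, hmu]
    _ = partitionedMoment φ X π := by simp

open Classical in
theorem mixedMoment_eq_sum_partitionedCumulant {φ : A →ₗ[ℂ] ℂ} {X : ι → A}
    (hX : Interchangeable φ X) {n : ℕ} (h : Fin n → ι) :
    mixedMoment φ X h = ∑ ρ with ρ ≤ Setoid.ker h, partitionedCumulant φ X ρ := by
  rw [mixedMoment_eq_partitionedMoment hX, partitionedMoment_eq_sum_partitionedCumulant]

end MoebiusInversion

/-! ### Moments of linear combinations -/

namespace SetPartition

open Classical in
/-- The block of a partition that corresponds to an element of the quotient. -/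
noncomputable def block {n : ℕ} (π : SetPartition n) (q : Quotient π) : Finset (Fin n) :=
  {k | Quotient.mk π k = q}

theorem mem_block {n : ℕ} {π : SetPartition n} {q : Quotient π} {k : Fin n} :
    k ∈ π.block q ↔ Quotient.mk π k = q := by
  simp [block]

theorem isPair_iff_card_block {n : ℕ} (π : SetPartition n) :
    π.IsPair ↔ ∀ q, #(π.block q) = 2 := by
  have h (y : Fin n) : {x | π x y} = (π.block (Quotient.mk π y) : Set (Fin n)) := by
    ext x
    simp only [Set.mem_ofPred_eq, mem_coe, mem_block]
    exact (Quotient.eq (r := π)).symm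
  constructor
  · rintro hπ ⟨y⟩
    have h1 := hπ _ ⟨y, rfl⟩
    rwa [h, Set.ncard_coe_finset] at h1
  · rintro hπ _ ⟨y, rfl⟩
    rw [h, Set.ncard_coe_finset]
    exact hπ _

open Classical in
/-- The weight `∏_{B ∈ π} ∑_i ∏_{k ∈ B} U_{g(k), i}` with which the cumulant of `π` enters the
moment `φ(Y_{g(1)} ⋯ Y_{g(n)})` of the linear combinations `Y_i = ∑_j U_{ij} X_j`. -/
noncomputable def blockWeight {n N : ℕ} (π : SetPartition n) (U : Matrix (Fin N) (Fin N) ℝ)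
    (g : Fin n → Fin N) : ℝ :=
  ∏ q : Quotient π, ∑ i, ∏ k ∈ π.block q, U (g k) i

open Classical in
theorem sum_prod_eq_blockWeight {n N : ℕ} (π : SetPartition n) (U : Matrix (Fin N) (Fin N) ℝ)
    (g : Fin n → Fin N) :
    ∑ j : Fin n → Fin N with π ≤ Setoid.ker j, ∏ k, U (g k) (j k) = π.blockWeight U g := by
  rw [blockWeight, Finset.prod_univ_sum, Fintype.piFinset_univ]
  symm
  -- The maps that are constant on the blocks of `π` are the maps on the quotient.
  refine Finset.sum_bij (fun j _ k => j (Quotient.mk π k)) ?_ ?_ ?_ ?_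
  · intro j _
    simp only [mem_filter, mem_univ, true_and]
    intro a b hab
    exact congrArg j (Quotient.sound hab)
  · intro j _ j' _ hjj
    funext q
    induction q using Quotient.inductionOn with
    | h k => exact congrFun hjj k
  · intro j hj
    simp only [mem_filter, mem_univ, true_and] at hj
    exact ⟨fun q => Quotient.lift j (fun a b hab => hj hab) q, mem_univ _, rfl⟩
  · intro j _
    rw [← Finset.prod_fiberwise univ (fun k => Quotient.mk π k)]
    refine Finset.prod_congr rfl fun q _ => ?_
    refine Finset.prod_congr rfl fun k hk => ?_
    rw [← (mem_filter.1 hk).2]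

end SetPartition

section LinearCombination

variable {A : Type*} [Ring A] [Algebra ℂ A] {ι : Type*}

theorem mixedMoment_sum_smul (φ : A →ₗ[ℂ] ℂ) {n N : ℕ} (X : Fin N → A)
    (c : Fin N → Fin N → ℂ) (g : Fin n → Fin N) :
    mixedMoment φ (fun i => ∑ j, c i j • X j) g =
      ∑ j : Fin n → Fin N, (∏ k, c (g k) (j k)) * mixedMoment φ X j := by
  simp only [mixedMoment, ← MultilinearMap.mkPiAlgebraFin_apply (R := ℂ)]
  rw [MultilinearMap.map_sum, _root_.map_sum]
  refine Finset.sum_congr rfl fun j _ => ?_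
  rw [MultilinearMap.map_smul_univ, _root_.map_smul, smul_eq_mul]

theorem mixedMoment_linearCombination [Infinite ι] {φ : A →ₗ[ℂ] ℂ} {X : ι → A}
    (hX : Interchangeable φ X) {n N : ℕ} (e : Fin N ↪ ι) (U : Matrix (Fin N) (Fin N) ℝ)
    (g : Fin n → Fin N) :
    mixedMoment φ (fun i => ∑ j, ((U i j : ℝ) : ℂ) • X (e j)) g =
      ∑ π : SetPartition n, partitionedCumulant φ X π * (π.blockWeight U g : ℂ) := by
  classical
  rw [mixedMoment_sum_smul φ (fun j => X (e j))]
  have hmom (j : Fin n → Fin N) : mixedMoment φ (fun i => X (e i)) j =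
      ∑ π : SetPartition n, if π ≤ Setoid.ker j then partitionedCumulant φ X π else 0 := by
    have hker : Setoid.ker (fun k => e (j k)) = Setoid.ker j :=
      Setoid.ext fun a b => e.injective.eq_iff
    rw [← Finset.sum_filter, ← hker]
    exact mixedMoment_eq_sum_partitionedCumulant hX (fun k => e (j k))
  simp_rw [hmom, Finset.mul_sum]
  rw [Finset.sum_comm]
  refine Finset.sum_congr rfl fun π _ => ?_
  rw [← SetPartition.sum_prod_eq_blockWeight, Finset.sum_filter]
  push_cast
  rw [Finset.mul_sum]
  refine Finset.sum_congr rfl fun j _ => ?_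
  split_ifs <;> simp [mul_comm]

end LinearCombination

/-! ### Weights of an orthogonal matrix -/

namespace SetPartition

open Classical in
theorem prod_forall_block_eq {n : ℕ} {κ : Type*} (π : SetPartition n) (g : Fin n → κ) :
    (∏ q : Quotient π, if ∀ k ∈ π.block q, ∀ l ∈ π.block q, g k = g l then (1 : ℝ) else 0) =
      if π ≤ Setoid.ker g then 1 else 0 := by
  rw [Finset.prod_ite_zero, Finset.prod_const_one]
  congr 1
  refine propext ⟨fun h k l hkl => ?_, fun h q _ k hk l hl => ?_⟩
  · exact h (Quotient.mk π l) (mem_univ _) k (mem_block.2 (Quotient.sound hkl)) l (mem_block.2 rfl)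
  · rw [mem_block] at hk hl
    exact h (Quotient.exact (hk.trans hl.symm))

open Classical in
theorem blockWeight_one {n N : ℕ} (π : SetPartition n) (g : Fin n → Fin N) :
    π.blockWeight 1 g = if π ≤ Setoid.ker g then 1 else 0 := by
  rw [← sum_prod_eq_blockWeight]
  have h (j : Fin n → Fin N) :
      ∏ k, (1 : Matrix (Fin N) (Fin N) ℝ) (g k) (j k) = if g = j then 1 else 0 := by
    simp [Matrix.one_apply, Finset.prod_ite_zero, funext_iff]
  simp [h, Finset.sum_ite_eq]

open Classical in
theorem blockWeight_of_isPair {n N : ℕ} {π : SetPartition n} (hπ : π.IsPair)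
    {U : Matrix (Fin N) (Fin N) ℝ} (hU : U ∈ Matrix.orthogonalGroup (Fin N) ℝ)
    (g : Fin n → Fin N) :
    π.blockWeight U g = if π ≤ Setoid.ker g then 1 else 0 := by
  rw [← prod_forall_block_eq, blockWeight]
  refine Finset.prod_congr rfl fun q _ => ?_
  obtain ⟨k, l, hkl, hq⟩ := Finset.card_eq_two.1 ((isPair_iff_card_block π).1 hπ q)
  have h1 := congrFun (congrFun ((Matrix.mem_orthogonalGroup_iff _ _).1 hU) (g k)) (g l)
  simp only [Matrix.mul_apply, Matrix.transpose_apply, Matrix.one_apply] at h1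
  simp only [hq, Finset.prod_pair hkl, h1]
  refine if_congr ?_ rfl rfl
  simp only [mem_insert, mem_singleton, forall_eq_or_imp, forall_eq]
  exact ⟨fun h => by simp [h], fun h => h.1.2⟩

end SetPartition

/-! ### The rotation by 45 degrees in a coordinate plane -/

/-- The orthogonal matrix that acts on the plane of the coordinates `a` and `b` by
`(x, y) ↦ ((x + y) / √2, (x - y) / √2)` and fixes all other coordinates. -/
noncomputable def planeRotation {N : ℕ} (a b : Fin N) : Matrix (Fin N) (Fin N) ℝ := fun i =>
  if i = a then (√2)⁻¹ • (Pi.single a 1 + Pi.single b 1)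
  else if i = b then (√2)⁻¹ • (Pi.single a 1 - Pi.single b 1)
  else Pi.single i 1

theorem planeRotation_left {N : ℕ} (a b : Fin N) :
    planeRotation a b a = (√2)⁻¹ • (Pi.single a 1 + Pi.single b 1) := by
  simp [planeRotation]

theorem planeRotation_right {N : ℕ} {a b : Fin N} (hab : a ≠ b) :
    planeRotation a b b = (√2)⁻¹ • (Pi.single a 1 - Pi.single b 1) := by
  simp [planeRotation, hab.symm]

theorem planeRotation_of_ne {N : ℕ} {a b i : Fin N} (ha : i ≠ a) (hb : i ≠ b) :
    planeRotation a b i = Pi.single i 1 := by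
  simp [planeRotation, ha, hb]

theorem planeRotation_mem_orthogonalGroup {N : ℕ} {a b : Fin N} (hab : a ≠ b) :
    planeRotation a b ∈ Matrix.orthogonalGroup (Fin N) ℝ := by
  have h2 : (√2)⁻¹ * (√2)⁻¹ + (√2)⁻¹ * (√2)⁻¹ = (1 : ℝ) := by
    rw [← mul_inv, Real.mul_self_sqrt (by norm_num)]
    norm_num
  rw [Matrix.mem_orthogonalGroup_iff]
  ext i j
  change planeRotation a b i ⬝ᵥ planeRotation a b j = _
  rw [Matrix.one_apply]
  rcases eq_or_ne i a with rfl | hia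
  · rcases eq_or_ne j i with rfl | hji
    · simp [planeRotation_left, hab, hab.symm, h2]
    rcases eq_or_ne j b with rfl | hjb
    · simp [planeRotation_left, planeRotation_right hab, hab, hab.symm]
    · simp [planeRotation_left, planeRotation_of_ne hji hjb, hji, hjb, hji.symm]
  rcases eq_or_ne i b with rfl | hib
  · rcases eq_or_ne j a with rfl | hja
    · simp [planeRotation_left, planeRotation_right hab, hab, hab.symm]
    rcases eq_or_ne j i with rfl | hji
    · simp [planeRotation_right hab, hab, hab.symm, mul_add, h2]
    · simp [planeRotation_right hab, planeRotation_of_ne hja hji, hja, hji, hji.symm]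
  rw [planeRotation_of_ne hia hib]
  rcases eq_or_ne j a with rfl | hja
  · simp [planeRotation_left, hia, hib]
  rcases eq_or_ne j b with rfl | hjb
  · simp [planeRotation_right hab, hia, hib]
  · simp [planeRotation_of_ne hja hjb, Pi.single_apply, eq_comm]

namespace SetPartition

variable {n N : ℕ} {π σ : SetPartition n} {g : Fin n → Fin N} {a b : Fin N}

/-- For `g` avoiding the fresh coordinate `b`, a block on which `g` is not constant kills the
weight: two different rows of the rotation matrix other than row `b` have disjoint supports. -/
theorem blockWeight_rotation_of_not_le (hg : ∀ k, g k ≠ b) (hσ : ¬ σ ≤ Setoid.ker g) :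
    σ.blockWeight (planeRotation a b) g = 0 := by
  classical
  obtain ⟨k, l, hkl, hne⟩ : ∃ k l, σ k l ∧ g k ≠ g l := by
    by_contra! h
    exact hσ fun k l hkl => h k l hkl
  have hdisj (i : Fin N) :
      planeRotation a b (g k) i = 0 ∨ planeRotation a b (g l) i = 0 := by
    have hk := hg k
    have hl := hg l
    rcases eq_or_ne (g k) a with hka | hka
    · rw [hka, planeRotation_left, planeRotation_of_ne (hka ▸ hne.symm) hl]
      rcases eq_or_ne i (g l) with rfl | hi
      · simp [hl, hka ▸ hne.symm]
      · simp [hi]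
    · rw [planeRotation_of_ne hka hk]
      rcases eq_or_ne i (g k) with rfl | hi
      · right
        rcases eq_or_ne (g l) a with hla | hla
        · simp [hla, planeRotation_left, hk, hka]
        · simp [planeRotation_of_ne hla hl, hne]
      · simp [hi]
  refine Finset.prod_eq_zero (mem_univ (Quotient.mk σ k)) (Finset.sum_eq_zero fun i _ => ?_)
  rcases hdisj i with h | h
  · exact Finset.prod_eq_zero (mem_block.2 rfl) h
  · exact Finset.prod_eq_zero (mem_block.2 (Quotient.sound (σ.symm hkl))) h

theorem blockWeight_rotation_of_ker_eq (hg : ∀ k, g k ≠ b) (hker : Setoid.ker g = π)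
    (k₀ : Fin n) :
    π.blockWeight (planeRotation (g k₀) b) g =
      2 * (√2)⁻¹ ^ #(π.block (Quotient.mk π k₀)) := by
  classical
  have hgk {k l : Fin n} : g k = g l ↔ Quotient.mk π k = Quotient.mk π l := by
    subst hker
    exact (Quotient.eq (r := Setoid.ker g)).symm
  have hcongr (q : Quotient π) (l : Fin n) (hl : Quotient.mk π l = q) (i : Fin N) :
      ∏ k ∈ π.block q, planeRotation (g k₀) b (g k) i =
        planeRotation (g k₀) b (g l) i ^ #(π.block q) := by
    rw [Finset.prod_congr rfl, Finset.prod_const]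
    intro k hk
    rw [hgk.2 ((mem_block.1 hk).trans hl.symm)]
  have hpos (q : Quotient π) (l : Fin n) (hl : Quotient.mk π l = q) : #(π.block q) ≠ 0 :=
    (Finset.card_pos.2 ⟨l, mem_block.2 hl⟩).ne'
  rw [blockWeight, Finset.prod_eq_single (Quotient.mk π k₀)]
  · have hrow (i : Fin N) : planeRotation (g k₀) b (g k₀) i =
        if i ∈ ({g k₀, b} : Finset (Fin N)) then (√2)⁻¹ else 0 := by
      rw [planeRotation_left]
      rcases eq_or_ne i (g k₀) with rfl | hi
      · simp [hg k₀]
      rcases eq_or_ne i b with rfl | hib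
      · simp [hi]
      · simp [hi, hib]
    simp_rw [hcongr _ k₀ rfl, hrow, ite_pow, zero_pow (hpos _ k₀ rfl)]
    rw [Finset.sum_ite_mem, univ_inter, Finset.sum_const, Finset.card_pair (hg k₀)]
    simp
  · intro q _ hq
    obtain ⟨l, rfl⟩ := Quotient.exists_rep q
    have hl : g l ≠ g k₀ := fun h => hq (hgk.1 h)
    simp_rw [hcongr _ l rfl]
    simp [planeRotation_of_ne hl (hg l), Pi.single_apply, ite_pow, zero_pow (hpos _ l rfl)]
  · simp

/-- A partition of `{1, …, n}` is the kernel of a map into `{1, …, n + 1}` that avoids the last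
point. -/
theorem exists_ker_eq_of_ne_last (π : SetPartition n) :
    ∃ g : Fin n → Fin (n + 1), (∀ k, g k ≠ Fin.last n) ∧ Setoid.ker g = π := by
  refine ⟨fun k => (Quotient.mk π k).out.castSucc, fun k => (Fin.castSucc_lt_last _).ne,
    Setoid.ext fun k l => ?_⟩
  rw [Setoid.ker_def, (Fin.castSucc_injective n).eq_iff, Quotient.out_injective.eq_iff]
  exact Quotient.eq (r := π)

end SetPartition

theorem two_mul_inv_sqrt_two_pow_ne_one {m : ℕ} (hm : m ≠ 2) : 2 * (√2)⁻¹ ^ m ≠ (1 : ℝ) := by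
  intro h
  have h1 : (√2 : ℝ) ^ m = √2 ^ 2 := by
    rw [Real.sq_sqrt (by norm_num)]
    rw [inv_pow, mul_inv_eq_one₀ (by positivity)] at h
    exact h.symm
  exact hm ((pow_right_inj₀ (by positivity)
    (by rw [ne_eq, Real.sqrt_eq_one]; norm_num)).1 h1)

/-! ### Maxwell's theorem -/

section Maxwell

variable {A : Type*} [Ring A] [Algebra ℂ A] {ι : Type*} [Infinite ι] {φ : A →ₗ[ℂ] ℂ} {X : ι → A}

open Classical in
theorem mixedMoment_embedding (hX : Interchangeable φ X) {n N : ℕ} (e : Fin N ↪ ι)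
    (g : Fin n → Fin N) :
    mixedMoment φ (fun i => X (e i)) g =
      ∑ π : SetPartition n,
        partitionedCumulant φ X π * ((if π ≤ Setoid.ker g then 1 else 0 : ℝ) : ℂ) := by
  simp_rw [← SetPartition.blockWeight_one, ← mixedMoment_linearCombination hX e]
  congr 1
  funext i
  simp [Matrix.one_apply]

theorem IsGaussianFamily.sphericallySymmetric (hX : Interchangeable φ X)
    (h : IsGaussianFamily φ X) : SphericallySymmetric φ X := by
  intro N e U hU n g
  rw [mixedMoment_linearCombination hX, mixedMoment_embedding hX]
  refine Finset.sum_congr rfl fun π _ => ?_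
  by_cases hπ : π.IsPair
  · rw [SetPartition.blockWeight_of_isPair hπ hU]
  · rw [h n π hπ, zero_mul, zero_mul]

theorem SphericallySymmetric.isGaussianFamily (hX : Interchangeable φ X)
    (h : SphericallySymmetric φ X) : IsGaussianFamily φ X := by
  classical
  intro n π
  induction π using WellFoundedLT.induction with
  | ind π ih =>
    intro hπ
    obtain ⟨q, hq⟩ : ∃ q, #(π.block q) ≠ 2 := by
      simpa [SetPartition.isPair_iff_card_block] using hπ
    obtain ⟨k₀, rfl⟩ := Quotient.exists_rep q
    obtain ⟨g, hg, hker⟩ := π.exists_ker_eq_of_ne_last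
    have hU := planeRotation_mem_orthogonalGroup (hg k₀)
    let e : Fin (n + 1) ↪ ι := Fin.valEmbedding.trans (Infinite.natEmbedding ι)
    have h1 := h (n + 1) e _ hU n g
    rw [mixedMoment_linearCombination hX, mixedMoment_embedding hX, ← sub_eq_zero,
      ← Finset.sum_sub_distrib, Finset.sum_eq_single π, ← mul_sub, mul_eq_zero] at h1
    · refine h1.resolve_right fun h2 => two_mul_inv_sqrt_two_pow_ne_one hq ?_
      rw [SetPartition.blockWeight_rotation_of_ker_eq hg hker, if_pos hker.ge] at h2
      exact_mod_cast sub_eq_zero.1 h2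
    · intro σ _ hσ
      by_cases hpair : σ.IsPair
      · rw [SetPartition.blockWeight_of_isPair hpair hU, sub_self]
      by_cases hle : σ ≤ Setoid.ker g
      · rw [ih σ (lt_of_le_of_ne (hker ▸ hle) hσ) hpair, zero_mul, zero_mul, sub_self]
      · rw [SetPartition.blockWeight_rotation_of_not_le hg hle, if_neg hle, sub_self]
    · simp

end Maxwell

theorem mainTheorem1 {A : Type*} [Ring A] [Algebra ℂ A] (φ : A →ₗ[ℂ] ℂ) (hφ : φ 1 = 1)
    {ι : Type*} [Infinite ι] (X : ι → A) (hX : Interchangeable φ X) :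
    IsGaussianFamily φ X ↔ SphericallySymmetric φ X :=
  ⟨fun h => h.sphericallySymmetric hX, fun h => h.isGaussianFamily hX⟩
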